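/- Let $k$ be an uncountable field of characteristic $0$. Let $\alpha_0,\alpha_1,\dots$ be indeterminates over $k$, let $K=k(\alpha_i : i\in\mathbb N)$, and let $p_0,p_1,\dots$ be a sequence of prime numbers such that $\mathbb Q=\bigcup_{i\ge 0}\frac{1}{p_0p_1\cdots p_{i-1}}\mathbb Z$. Put $R_i=K[t_i,t_i^{-1}]$, let $\varphi_i:R_i\to R_{i+1}$ be the $K$-algebra homomorphism with $\varphi_i(t_i)=\alpha_i^{-1}t_{i+1}^{p_i}$, and let $R=R(k,1)=\varinjlim R_i$ be the direct limit along the maps $\varphi_i$. Then: 1. $R$ is a Noetherian ring, and it is $\mathbb Q$-graded with $K$ in degree $0$ and $\deg(t_i)=\frac{1}{p_0p_1\cdots p_{i-1}}$. 2. $R$ is a principal ideal domain. Each $R_i$ is a principal ideal ring, and every prime ideal of $R$ is extended from some $R_i$, that is, it has the form $QR$ for some $i$ and some prime ideal $Q$ of $R_i$. 3. $R$ is not a Euclidean domain. More precisely, there is no well-founded relation $\prec$ on $R$ such that for all $a,b\in R$ with $b\neq 0$ there are $q,s\in R$ with $a=bq+s$ and $s=0$ or $s\prec b$; in particular there is no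 function $N:R\to\mathbb N$ such that for all $a,b\in R$ with $b\neq 0$ there are $q,s\in R$ with $a=bq+s$ and $s=0$ or $N(s)<N(b)$. 4. For every nonzero prime element $f\in R$, the natural homomorphism of unit groups $R^*\to (R/fR)^*$ is not surjective. -/

import Mathlib

open scoped LaurentPolynomial

noncomputable section

namespace RationalGraded

/-- The field `K = k(α₀, α₁, α₂, …)` of rational functions in countably many indeterminates. -/
abbrev CoeffField (k : Type*) [Field k] : Type _ := FractionRing (MvPolynomial ℕ k)

/-- The indeterminate `αᵢ`, as an element of `K`. -/
def alpha (k : Type*) [Field k] (i : ℕ) : CoeffField k :=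
  algebraMap (MvPolynomial ℕ k) (CoeffField k) (MvPolynomial.X i)

theorem alpha_ne_zero (k : Type*) [Field k] (i : ℕ) : alpha k i ≠ 0 := by
  unfold alpha
  rw [Ne, IsFractionRing.to_map_eq_zero_iff]
  exact MvPolynomial.X_ne_zero i

/-- The Laurent polynomial ring `Rᵢ = K[tᵢ, tᵢ⁻¹]`. All levels are copies of one ring; `tᵢ` is the
monomial `T 1` at level `i`. -/
abbrev Level (k : Type*) [Field k] (_i : ℕ) : Type _ := (CoeffField k)[T;T⁻¹]

/-- The image `αᵢ⁻¹ tᵢ₊₁ ^ pᵢ` of `tᵢ`, as a unit of `Rᵢ₊₁`. -/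
def stepUnit (k : Type*) [Field k] (p : ℕ → ℕ) (i : ℕ) : (Level k (i + 1))ˣ where
  val := LaurentPolynomial.C (alpha k i)⁻¹ * LaurentPolynomial.T (p i : ℤ)
  inv := LaurentPolynomial.C (alpha k i) * LaurentPolynomial.T (-(p i : ℤ))
  val_inv := by
    rw [mul_mul_mul_comm, ← map_mul, ← LaurentPolynomial.T_add,
      inv_mul_cancel₀ (alpha_ne_zero k i), add_neg_cancel, map_one, LaurentPolynomial.T_zero,
      one_mul]
  inv_val := by
    rw [mul_mul_mul_comm, ← map_mul, ← LaurentPolynomial.T_add,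
      mul_inv_cancel₀ (alpha_ne_zero k i), neg_add_cancel, map_one, LaurentPolynomial.T_zero,
      one_mul]

/-- The ring homomorphism `φᵢ : Rᵢ → Rᵢ₊₁` that fixes `K` and maps `tᵢ` to
`αᵢ⁻¹ tᵢ₊₁ ^ pᵢ`. -/
def step (k : Type*) [Field k] (p : ℕ → ℕ) (i : ℕ) : Level k i →+* Level k (i + 1) :=
  LaurentPolynomial.eval₂ LaurentPolynomial.C (stepUnit k p i)

/-- The composite `φᵢ₊ₙ₋₁ ∘ ⋯ ∘ φᵢ : Rᵢ → Rᵢ₊ₙ`. -/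
def stepIter (k : Type*) [Field k] (p : ℕ → ℕ) (i : ℕ) : (n : ℕ) → Level k i →+* Level k (i + n)
  | 0 => RingHom.id _
  | n + 1 => (step k p (i + n)).comp (stepIter k p i n)

/-- The transition map `Rᵢ → Rⱼ` for `i ≤ j`. -/
def transition (k : Type*) [Field k] (p : ℕ → ℕ) (i j : ℕ) (_h : i ≤ j) :
    Level k i →+* Level k j :=
  stepIter k p i (j - i)

theorem stepIter_add (k : Type*) [Field k] (p : ℕ → ℕ) (i m n : ℕ) (x : Level k i) :
    stepIter k p (i + m) n (stepIter k p i m x) = stepIter k p i (m + n) x := by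
  induction n with
  | zero => rfl
  | succ n ih =>
    change step k p (i + m + n) (stepIter k p (i + m) n (stepIter k p i m x)) =
      step k p (i + (m + n)) (stepIter k p i (m + n) x)
    rw [ih]
    exact congrArg (fun l => (step k p l : (CoeffField k)[T;T⁻¹] →+* (CoeffField k)[T;T⁻¹])
      (stepIter k p i (m + n) x)) (add_assoc i m n)

instance (k : Type*) [Field k] (p : ℕ → ℕ) :
    DirectedSystem (Level k) (fun i j h => transition k p i j h) where
  map_self i x := by
    change stepIter k p i (i - i) x = x
    rw [Nat.sub_self]
    rfl
  map_map := by
    intro c b a hab hbc x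
    obtain ⟨m, rfl⟩ := Nat.exists_eq_add_of_le hab
    obtain ⟨n, rfl⟩ := Nat.exists_eq_add_of_le hbc
    have h₁ : a + m - a = m := by omega
    have h₂ : a + m + n - (a + m) = n := by omega
    have h₃ : a + m + n - a = m + n := by omega
    change stepIter k p (a + m) (a + m + n - (a + m)) (stepIter k p a (a + m - a) x) =
      stepIter k p a (a + m + n - a) x
    rw [h₁, h₂, h₃]
    exact stepIter_add k p a m n x

/-- The ring `R(k,1)`: the direct limit of the `Rᵢ` along the maps `φᵢ`. -/
abbrev R (k : Type*) [Field k] (p : ℕ → ℕ) : Type _ :=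
  Ring.DirectLimit (Level k) (fun i j h => transition k p i j h)

/-- The canonical map `Rᵢ → R(k,1)`. -/
abbrev fromLevel (k : Type*) [Field k] (p : ℕ → ℕ) (i : ℕ) : Level k i →+* R k p :=
  Ring.DirectLimit.of (Level k) (fun i j h => transition k p i j h) i

/-- The homogeneous component of degree `q ∈ ℚ` of `R(k,1)`, for the grading in which `K` has
degree `0` and `tᵢ` has degree `1 / (p₀ ⋯ pᵢ₋₁)`: the additive subgroup generated by the monomials
`c tᵢⁿ` with `c ∈ K` and `n / (p₀ ⋯ pᵢ₋₁) = q`. -/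
def homogeneousPart (k : Type*) [Field k] (p : ℕ → ℕ) (q : ℚ) : AddSubgroup (R k p) :=
  AddSubgroup.closure {x | ∃ (i : ℕ) (n : ℤ) (c : CoeffField k),
    (n : ℚ) / ((∏ j ∈ Finset.range i, p j : ℕ) : ℚ) = q ∧
    x = fromLevel k p i (LaurentPolynomial.C c * LaurentPolynomial.T n)}

/-- `A` admits division with remainder with respect to some well-founded relation on `A`.
This is the most permissive form of the Euclidean property of a domain: a Euclidean
function with values in `ℕ`, or in any well-ordered set, gives such a relation, and no
compatibility with multiplication is asked. -/
def HasEuclideanDivision (A : Type*) [CommRing A] : Prop :=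
  ∃ r : A → A → Prop, WellFounded r ∧
    ∀ a b : A, b ≠ 0 → ∃ q s : A, a = b * q + s ∧ (s = 0 ∨ r s b)

theorem HasEuclideanDivision.of_nat_norm {A : Type*} [CommRing A] (N : A → ℕ)
    (h : ∀ a b : A, b ≠ 0 → ∃ q s : A, a = b * q + s ∧ (s = 0 ∨ N s < N b)) :
    HasEuclideanDivision A :=
  ⟨InvImage (· < ·) N, InvImage.wf N wellFounded_lt, h⟩

theorem HasEuclideanDivision.of_euclideanDomain {A : Type*} [EuclideanDomain A] :
    HasEuclideanDivision A :=
  ⟨EuclideanDomain.r, EuclideanDomain.r_wellFounded, fun a b hb =>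
    ⟨a / b, a % b, (EuclideanDomain.div_add_mod a b).symm, Or.inr (EuclideanDomain.mod_lt a hb)⟩⟩

end RationalGraded

end

/-!
The ring `R` is a principal ideal domain because it is both Bézout and factorial. It is Bézout
because any two elements lie in one level `Rᵢ = K[tᵢ, tᵢ⁻¹]`, a principal ideal ring. It is factorial
because it is a localization of the polynomial ring `k[t₀, t₁, …]`: as `αᵢ = tᵢ₊₁ ^ pᵢ / tᵢ`, every
element of `R` is a fraction of polynomials in the `tᵢ` (`exists_mul_ofMvPolynomial_eq`), and the
`tᵢ` are algebraically independent over `k` (`ofMvPolynomial_injective`). The latter is seen by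
mapping `R` to `k(X₀, X₁, …)` through `tᵢ ↦ Xᵢ`, `αᵢ ↦ Xᵢ₊₁ ^ pᵢ / Xᵢ`; the substitution for the `αᵢ`
is injective since its effect on exponents is triangular. A prime ideal `fR` is extended from its
contraction to any level that contains `f`.

For the grading, sending `c tᵢⁿ` to its own homogeneous part extends, by the universal property of
the direct limit, to a ring homomorphism from `R` to the direct sum of the homogeneous parts, and
this is inverse to summation.

Units that fail to lift come from a cardinality count (`not_surjective_units_map`). The units of `R`
are the monomials `c tᵢⁿ`, so `Rˣ / Kˣ` is countable. For a maximal ideal `M` the field `R / M` is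
larger than `K`, since a `K`-point of `R` would provide roots `βᵢ₊₁ ^ pᵢ = αᵢ βᵢ` in `K`, against a
count of degrees in a late `α_N` (`comp_coeffMap_ne_id`); and for `θ ∈ R / M` outside `K`, the units
`θ + c` with `c` in the uncountable field `k` are pairwise independent modulo `Kˣ`.

In a division with remainder, an element `b` that is minimal among the nonzero nonunits leaves only
remainders that are zero or units. Then `bR` is maximal and all units modulo `b` lift, which was just
excluded.
-/

open scoped LaurentPolynomial

noncomputable section

namespace RationalGraded

open LaurentPolynomial

/-! ### Generators, universal property and units of the direct limit -/

section Basics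

variable (k : Type*) [Field k] (p : ℕ → ℕ)

/-- The structure map `K → R`. Every level induces the same map (`fromLevel_C`). -/
def coeffMap : CoeffField k →+* R k p := (fromLevel k p 0).comp C

/-- The element `tᵢ` of `R`, as a unit. -/
def tUnit (i : ℕ) : (R k p)ˣ :=
  Units.map (fromLevel k p i).toMonoidHom
    ⟨T 1, T (-1), by rw [← T_add]; simp, by rw [← T_add]; simp⟩

variable {k p}

theorem step_C (i : ℕ) (c : CoeffField k) : step k p i (C c) = C c :=
  eval₂_C _ _ _

theorem step_T (i : ℕ) (n : ℤ) : step k p i (T n) = ((stepUnit k p i ^ n : (Level k (i + 1))ˣ) :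
    Level k (i + 1)) :=
  eval₂_T _ _ _

theorem transition_succ (i : ℕ) (x : Level k i) :
    transition k p i (i + 1) (Nat.le_succ i) x = step k p i x := by
  change stepIter k p i (i + 1 - i) x = _
  rw [Nat.add_sub_cancel_left]
  rfl

theorem fromLevel_step (i : ℕ) (x : Level k i) :
    fromLevel k p (i + 1) (step k p i x) = fromLevel k p i x := by
  rw [← transition_succ]
  exact Ring.DirectLimit.of_f (G := Level k) (f := fun i j h => transition k p i j h)
    (Nat.le_succ i) x

theorem exists_fromLevel (x : R k p) : ∃ i y, fromLevel k p i y = x :=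
  Ring.DirectLimit.exists_of x

theorem fromLevel_C (i : ℕ) (c : CoeffField k) : fromLevel k p i (C c) = coeffMap k p c := by
  induction i with
  | zero => rfl
  | succ i ih => rw [← ih, ← fromLevel_step i, step_C]

theorem fromLevel_T (i : ℕ) (n : ℤ) :
    fromLevel k p i (T n) = ((tUnit k p i ^ n : (R k p)ˣ) : R k p) := by
  rw [tUnit, ← map_zpow, Units.coe_map]
  refine congrArg (fromLevel k p i) ?_
  obtain ⟨m, rfl | rfl⟩ := n.eq_nat_or_neg
  · simp [T_pow]
  · simp [T_pow]

theorem coeffMap_alpha_mul (i : ℕ) :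
    coeffMap k p (alpha k i) * tUnit k p i = (tUnit k p (i + 1) : R k p) ^ p i := by
  have h := fromLevel_T (k := k) (p := p) i 1
  rw [zpow_one] at h
  rw [← h, ← fromLevel_step, step_T, zpow_one, ← fromLevel_C (i + 1), ← map_mul]
  have h2 := fromLevel_T (k := k) (p := p) (i + 1) (p i)
  rw [zpow_natCast, Units.val_pow_eq_pow_val] at h2
  rw [← h2]
  congr 1
  change C _ * (C _ * T _) = _
  rw [← mul_assoc, ← map_mul, mul_inv_cancel₀ (alpha_ne_zero k i), map_one, one_mul]

theorem fromLevel_mono {i j : ℕ} (h : i ≤ j) (x : Level k i) :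
    ∃ y : Level k j, fromLevel k p j y = fromLevel k p i x :=
  ⟨_, Ring.DirectLimit.of_f (G := Level k) (f := fun i j h => transition k p i j h) h x⟩

theorem exists_fromLevel₂ (x y : R k p) :
    ∃ i a b, fromLevel k p i a = x ∧ fromLevel k p i b = y := by
  obtain ⟨i, a, rfl⟩ := exists_fromLevel x
  obtain ⟨j, b, rfl⟩ := exists_fromLevel y
  obtain ⟨a', ha⟩ := fromLevel_mono (le_max_left i j) a
  obtain ⟨b', hb⟩ := fromLevel_mono (le_max_right i j) b
  exact ⟨_, a', b', ha, hb⟩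

/-- Two elements of one level that agree in `R` agree at a later level. -/
theorem exists_transition_eq {i : ℕ} {x y : Level k i}
    (h : fromLevel k p i x = fromLevel k p i y) :
    ∃ j, ∃ hij : i ≤ j, transition k p i j hij x = transition k p i j hij y := by
  obtain ⟨j, hij, hj⟩ := Ring.DirectLimit.of.zero_exact (G := Level k)
    (f' := fun i j h => transition k p i j h) (x := x - y) (by
      rw [map_sub]; exact sub_eq_zero.2 h)
  exact ⟨j, hij, by rwa [map_sub, sub_eq_zero] at hj⟩

/-- The elements of `R` are sums of monomials `c tᵢⁿ`. -/
theorem monomial_induction {motive : R k p → Prop}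
    (monomial : ∀ c i (n : ℤ), motive (coeffMap k p c * ((tUnit k p i ^ n : (R k p)ˣ) : R k p)))
    (add : ∀ x y, motive x → motive y → motive (x + y)) (x : R k p) : motive x := by
  obtain ⟨i, y, rfl⟩ := exists_fromLevel x
  induction y using LaurentPolynomial.induction_on' with
  | add f g hf hg => rw [map_add]; exact add _ _ hf hg
  | C_mul_T n c => rw [map_mul, fromLevel_C, fromLevel_T]; exact monomial c i n

theorem ringHom_ext {S : Type*} [Semiring S] {f g : R k p →+* S}
    (hc : ∀ c, f (coeffMap k p c) = g (coeffMap k p c))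
    (ht : ∀ i, f (tUnit k p i) = g (tUnit k p i)) : f = g := by
  ext x
  have hu (i : ℕ) : Units.map f.toMonoidHom (tUnit k p i) = Units.map g.toMonoidHom (tUnit k p i) :=
    Units.ext (ht i)
  have hz (i : ℕ) (n : ℤ) : f ((tUnit k p i ^ n : (R k p)ˣ) : R k p) =
      g ((tUnit k p i ^ n : (R k p)ˣ) : R k p) := by
    have h := congrArg (fun u : Sˣ => ((u ^ n : Sˣ) : S)) (hu i)
    rw [← map_zpow, ← map_zpow] at h
    exact h
  induction x using monomial_induction with
  | monomial c i n => rw [map_mul, map_mul, hc, hz]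
  | add x y hx hy => rw [map_add, map_add, hx, hy]

variable (p) in
/-- The universal property of `R`: a ring homomorphism out of `R` is a ring homomorphism `g` out of
`K` together with units `uᵢ` such that `g(αᵢ) uᵢ = uᵢ₊₁ ^ pᵢ`. -/
def lift {S : Type*} [CommRing S] (g : CoeffField k →+* S) (u : ℕ → Sˣ)
    (h : ∀ i, g (alpha k i) * u i = (u (i + 1) : S) ^ p i) : R k p →+* S :=
  Ring.DirectLimit.lift _ _ _ (fun i => eval₂ g (u i)) (by
    have hstep (i : ℕ) (x : Level k i) : eval₂ g (u (i + 1)) (step k p i x) = eval₂ g (u i) x := by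
      have hu : Units.map (eval₂ g (u (i + 1))).toMonoidHom (stepUnit k p i) = u i := by
        ext
        change eval₂ g (u (i + 1)) (C (alpha k i)⁻¹ * T (p i : ℤ)) = _
        rw [eval₂_C_mul_T_n, ← h, ← mul_assoc, ← map_mul,
          inv_mul_cancel₀ (alpha_ne_zero k i), map_one, one_mul]
      induction x using LaurentPolynomial.induction_on' with
      | add f g hf hg => rw [map_add, map_add, map_add, hf, hg]
      | C_mul_T n c =>
        rw [map_mul, step_C, step_T, map_mul, eval₂_C, eval₂_C_mul_T, ← hu, ← map_zpow]
        rfl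
    intro i j hij x
    obtain ⟨n, rfl⟩ := Nat.exists_eq_add_of_le hij
    change eval₂ g (u (i + n)) (stepIter k p i (i + n - i) x) = _
    rw [Nat.add_sub_cancel_left]
    clear hij
    induction n with
    | zero => rfl
    | succ n ih => exact (hstep (i + n) _).trans ih)

section lift

variable {S : Type*} [CommRing S] (g : CoeffField k →+* S) (u : ℕ → Sˣ)
    (h : ∀ i, g (alpha k i) * u i = (u (i + 1) : S) ^ p i)

theorem lift_fromLevel (i : ℕ) (x : Level k i) :
    lift p g u h (fromLevel k p i x) = eval₂ g (u i) x :=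
  Ring.DirectLimit.lift_of _ _ _ _ _

theorem lift_coeffMap (c : CoeffField k) : lift p g u h (coeffMap k p c) = g c := by
  rw [← fromLevel_C 0, lift_fromLevel, eval₂_C]

theorem lift_tUnit_zpow (i : ℕ) (n : ℤ) :
    lift p g u h ((tUnit k p i ^ n : (R k p)ˣ) : R k p) = ((u i ^ n : Sˣ) : S) := by
  rw [← fromLevel_T, lift_fromLevel, eval₂_T]

theorem lift_tUnit (i : ℕ) : lift p g u h (tUnit k p i) = u i := by
  simpa using lift_tUnit_zpow g u h i 1

end lift

/-- The units of the Laurent polynomial ring over a field are the nonzero monomials. -/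
theorem exists_eq_C_mul_T_of_isUnit {F : Type*} [Field F] {x : F[T;T⁻¹]} (hx : IsUnit x) :
    ∃ c n, x = C c * T n := by
  obtain ⟨y, hxy⟩ := hx.exists_right_inv
  obtain ⟨m, f, hf⟩ := exists_T_pow x
  obtain ⟨n, g, hg⟩ := exists_T_pow y
  have hfg : f * g = Polynomial.X ^ (m + n) := by
    apply Polynomial.toLaurent_injective
    rw [map_mul, hf, hg, Polynomial.toLaurent_X_pow, mul_mul_mul_comm, hxy, one_mul, ← T_add]
    push_cast
    rfl
  obtain ⟨i, -, hi⟩ := (dvd_prime_pow Polynomial.prime_X _).1 ⟨g, hfg.symm⟩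
  obtain ⟨u, hu⟩ := hi.symm
  obtain ⟨c, -, hc⟩ := Polynomial.isUnit_iff.1 u.isUnit
  refine ⟨c, i - m, ?_⟩
  have : x = Polynomial.toLaurent f * T (-m) := by
    rw [hf, mul_T_assoc, add_neg_cancel, T_zero, mul_one]
  rw [this, ← hu, ← hc, map_mul, Polynomial.toLaurent_X_pow, Polynomial.toLaurent_C, T_sub]
  ring

/-- The units of `R` are monomials: an inverse exists at a finite level already. -/
theorem exists_eq_monomial_of_isUnit {x : R k p} (hx : IsUnit x) :
    ∃ c i, ∃ n : ℤ, x = coeffMap k p c * ((tUnit k p i ^ n : (R k p)ˣ) : R k p) := by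
  obtain ⟨y, hxy⟩ := hx.exists_right_inv
  obtain ⟨i, a, b, rfl, rfl⟩ := exists_fromLevel₂ x y
  rw [← map_mul, ← map_one (fromLevel k p i)] at hxy
  obtain ⟨j, hij, hj⟩ := exists_transition_eq hxy
  rw [map_mul, map_one] at hj
  obtain ⟨c, n, hn⟩ := exists_eq_C_mul_T_of_isUnit (IsUnit.of_mul_eq_one _ hj)
  refine ⟨c, j, n, ?_⟩
  rw [← fromLevel_C j, ← fromLevel_T, ← map_mul, ← hn]
  exact (Ring.DirectLimit.of_f (G := Level k) (f := fun i j h => transition k p i j h) hij a).symm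

end Basics

/-! ### Factoriality and the principal ideal property -/

section Factorial

variable (k : Type*) [Field k] (p : ℕ → ℕ)

/-- The Laurent polynomial ring over `k` in the variables `X₀, X₁, …`. -/
abbrev MvLaurent : Type _ := AddMonoidAlgebra k (ℕ →₀ ℤ)

/-- The effect on exponents of the substitution `αᵢ ↦ Xᵢ₊₁ ^ pᵢ / Xᵢ`. -/
def exponentMap : (ℕ →₀ ℕ) →+ (ℕ →₀ ℤ) :=
  Finsupp.liftAddHom fun i =>
    multiplesHom _ (Finsupp.single (i + 1) (p i : ℤ) - Finsupp.single i 1)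

variable {p} in
theorem exponentMap_single (i n : ℕ) : exponentMap p (Finsupp.single i n) =
    n • (Finsupp.single (i + 1) (p i : ℤ) - Finsupp.single i 1) := by
  rw [exponentMap, Finsupp.liftAddHom_apply_single, multiplesHom_apply]

theorem exponentMap_zero (e : ℕ →₀ ℕ) : exponentMap p e 0 = -(e 0 : ℤ) := by
  induction e using Finsupp.induction_linear with
  | zero => simp
  | add e f he hf => rw [map_add, Finsupp.add_apply, he, hf, Finsupp.add_apply]; push_cast; ring
  | single i n => rw [exponentMap_single]; rcases eq_or_ne i 0 with rfl | hi <;> simp [*]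

theorem exponentMap_succ (e : ℕ →₀ ℕ) (j : ℕ) :
    exponentMap p e (j + 1) = p j * e j - e (j + 1) := by
  induction e using Finsupp.induction_linear with
  | zero => simp
  | add e f he hf =>
    rw [map_add (exponentMap p), Finsupp.add_apply, he, hf]
    simp only [Finsupp.add_apply]
    push_cast
    ring
  | single i n =>
    rw [exponentMap_single]
    rcases eq_or_ne i j with rfl | hi
    · simp [mul_comm]
    · rcases eq_or_ne i (j + 1) with rfl | hi' <;> simp [*]

theorem exponentMap_injective : Function.Injective (exponentMap p) := by
  intro e f h
  ext j
  induction j with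
  | zero =>
    have := DFunLike.congr_fun h 0
    rw [exponentMap_zero, exponentMap_zero] at this
    omega
  | succ j ih =>
    have := DFunLike.congr_fun h (j + 1)
    rw [exponentMap_succ, exponentMap_succ, ih] at this
    omega

/-- The substitution `αᵢ ↦ Xᵢ₊₁ ^ pᵢ / Xᵢ`, on polynomials in the `αᵢ`. -/
def substitution : MvPolynomial ℕ k →+* MvLaurent k :=
  AddMonoidAlgebra.mapDomainRingHom k (exponentMap p)

theorem substitution_injective : Function.Injective (substitution k p) :=
  AddMonoidAlgebra.mapDomain_injective (exponentMap_injective p)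

theorem substitution_X (i : ℕ) : substitution k p (MvPolynomial.X i) =
    AddMonoidAlgebra.single (Finsupp.single (i + 1) (p i : ℤ) - Finsupp.single i 1) 1 := by
  have := AddMonoidAlgebra.mapDomain_single (f := exponentMap p)
    (a := Finsupp.single i 1) (r := (1 : k))
  rw [exponentMap_single, one_smul] at this
  exact this

theorem substitution_C (c : k) : substitution k p (MvPolynomial.C c) =
    AddMonoidAlgebra.single 0 c := by
  have := AddMonoidAlgebra.mapDomain_single (f := exponentMap p)
    (a := 0) (r := c)
  rw [map_zero] at this
  exact this

/-- The inclusion of the polynomials into the Laurent polynomials. -/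
def mvToLaurent : MvPolynomial ℕ k →+* MvLaurent k :=
  AddMonoidAlgebra.mapDomainRingHom k (Finsupp.mapRange.addMonoidHom (Nat.castAddMonoidHom ℤ))

theorem mvToLaurent_injective : Function.Injective (mvToLaurent k) :=
  AddMonoidAlgebra.mapDomain_injective
    (Finsupp.mapRange_injective _ (map_zero _) Nat.cast_injective)

theorem mvToLaurent_X (i : ℕ) : mvToLaurent k (MvPolynomial.X i) =
    AddMonoidAlgebra.single (Finsupp.single i 1) 1 := by
  have := AddMonoidAlgebra.mapDomain_single
    (f := Finsupp.mapRange.addMonoidHom (Nat.castAddMonoidHom ℤ))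
    (a := Finsupp.single i 1) (r := (1 : k))
  simp only [Finsupp.mapRange.addMonoidHom_apply, Finsupp.mapRange_single] at this
  exact this

theorem mvToLaurent_C (c : k) : mvToLaurent k (MvPolynomial.C c) =
    AddMonoidAlgebra.single 0 c := by
  have := AddMonoidAlgebra.mapDomain_single
    (f := Finsupp.mapRange.addMonoidHom (ι := ℕ) (Nat.castAddMonoidHom ℤ))
    (a := 0) (r := c)
  rw [map_zero] at this
  exact this

instance : IsDomain (MvLaurent k) := NoZeroDivisors.to_isDomain _

/-- The embedding of `K` in the field `k(X₀, X₁, …)` with `αᵢ ↦ Xᵢ₊₁ ^ pᵢ / Xᵢ`. -/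
def coeffToFraction : CoeffField k →+* FractionRing (MvLaurent k) :=
  IsFractionRing.lift (g := (algebraMap (MvLaurent k) (FractionRing (MvLaurent k))).comp
    (substitution k p))
    ((IsFractionRing.injective _ _).comp (substitution_injective k p))

/-- The variable `Xᵢ` as a unit of `k(X₀, X₁, …)`. -/
def fractionUnit (i : ℕ) : (FractionRing (MvLaurent k))ˣ :=
  Units.map (algebraMap (MvLaurent k) (FractionRing (MvLaurent k))).toMonoidHom
    ⟨.single (Finsupp.single i 1) 1, .single (-Finsupp.single i 1) 1,
      by simp [AddMonoidAlgebra.single_mul_single, AddMonoidAlgebra.one_def],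
      by simp [AddMonoidAlgebra.single_mul_single, AddMonoidAlgebra.one_def]⟩

theorem fractionUnit_coe (i : ℕ) : (fractionUnit k i : FractionRing (MvLaurent k)) =
    algebraMap _ _ (AddMonoidAlgebra.single (Finsupp.single i 1) (1 : k) : MvLaurent k) := rfl

theorem coeffToFraction_algebraMap (a : MvPolynomial ℕ k) :
    coeffToFraction k p (algebraMap _ _ a) = algebraMap _ _ (substitution k p a) :=
  IsFractionRing.lift_algebraMap _ _

theorem coeffToFraction_alpha_mul (i : ℕ) :
    coeffToFraction k p (alpha k i) * fractionUnit k i =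
      (fractionUnit k (i + 1) : FractionRing (MvLaurent k)) ^ p i := by
  rw [alpha, coeffToFraction_algebraMap, substitution_X, fractionUnit_coe, fractionUnit_coe,
    ← map_mul, ← map_pow, AddMonoidAlgebra.single_mul_single, AddMonoidAlgebra.single_pow]
  simp

/-- The ring homomorphism `R → k(X₀, X₁, …)` with `tᵢ ↦ Xᵢ`. -/
def toFraction : R k p →+* FractionRing (MvLaurent k) :=
  lift p (coeffToFraction k p) (fractionUnit k) (coeffToFraction_alpha_mul k p)

/-- The ring homomorphism `k[X₀, X₁, …] → R` with `Xᵢ ↦ tᵢ`. -/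
def ofMvPolynomial : MvPolynomial ℕ k →+* R k p :=
  MvPolynomial.eval₂Hom ((coeffMap k p).comp ((algebraMap (MvPolynomial ℕ k) _).comp MvPolynomial.C))
    fun i => (tUnit k p i : R k p)

theorem toFraction_comp_ofMvPolynomial : (toFraction k p).comp (ofMvPolynomial k p) =
    (algebraMap (MvLaurent k) _).comp (mvToLaurent k) := by
  apply MvPolynomial.ringHom_ext
  · intro c
    simp only [RingHom.comp_apply, ofMvPolynomial, MvPolynomial.eval₂Hom_C, toFraction,
      lift_coeffMap, coeffToFraction_algebraMap, substitution_C, mvToLaurent_C]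
  · intro i
    simp only [RingHom.comp_apply, ofMvPolynomial, MvPolynomial.eval₂Hom_X', toFraction,
      lift_tUnit, mvToLaurent_X, fractionUnit_coe]

/-- The elements `tᵢ` of `R` are algebraically independent over `k`. -/
theorem ofMvPolynomial_injective : Function.Injective (ofMvPolynomial k p) := by
  apply Function.Injective.of_comp (f := toFraction k p)
  rw [← RingHom.coe_comp, toFraction_comp_ofMvPolynomial, RingHom.coe_comp]
  exact (IsFractionRing.injective _ _).comp (mvToLaurent_injective k)

instance : Nontrivial (R k p) := (toFraction k p).domain_nontrivial

instance : IsDomain (R k p) :=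
  have : NoZeroDivisors (R k p) := ⟨by
    intro x y hxy
    obtain ⟨i, a, b, rfl, rfl⟩ := exists_fromLevel₂ x y
    rw [← map_mul, ← map_zero (fromLevel k p i)] at hxy
    obtain ⟨j, hij, hj⟩ := exists_transition_eq hxy
    rw [map_mul, map_zero] at hj
    have hof (z : Level k i) (hz : transition k p i j hij z = 0) : fromLevel k p i z = 0 := by
      rw [← map_zero (fromLevel k p j), ← hz]
      exact (Ring.DirectLimit.of_f (G := Level k) (f := fun i j h => transition k p i j h)
        hij z).symm
    exact (mul_eq_zero.1 hj).imp (hof a) (hof b)⟩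
  NoZeroDivisors.to_isDomain _

/-- `R` is a localization of `k[X₀, X₁, …]`: the elements `αᵢ = tᵢ₊₁ ^ pᵢ / tᵢ` are fractions of
polynomials in the `tᵢ`, hence so are all elements. -/
theorem exists_mul_ofMvPolynomial_eq (x : R k p) :
    ∃ a b, IsUnit (ofMvPolynomial k p b) ∧ x * ofMvPolynomial k p b = ofMvPolynomial k p a := by
  let frac : Subring (R k p) :=
    { carrier := {x | ∃ a b, IsUnit (ofMvPolynomial k p b) ∧
        x * ofMvPolynomial k p b = ofMvPolynomial k p a}
      mul_mem' := by
        rintro x y ⟨a, b, hb, h⟩ ⟨a', b', hb', h'⟩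
        exact ⟨a * a', b * b', by rw [map_mul]; exact hb.mul hb', by
          rw [map_mul, map_mul, mul_mul_mul_comm, h, h']⟩
      one_mem' := ⟨1, 1, by simp, by simp⟩
      add_mem' := by
        rintro x y ⟨a, b, hb, h⟩ ⟨a', b', hb', h'⟩
        exact ⟨a * b' + a' * b, b * b', by rw [map_mul]; exact hb.mul hb', by
          simp only [map_mul, map_add, ← h, ← h']; ring⟩
      zero_mem' := ⟨0, 1, by simp, by simp⟩
      neg_mem' := by
        rintro x ⟨a, b, hb, h⟩
        exact ⟨-a, b, hb, by rw [map_neg, ← h, neg_mul]⟩ }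
  have hinv (u : (R k p)ˣ) (hu : (u : R k p) ∈ frac) : ((u⁻¹ : (R k p)ˣ) : R k p) ∈ frac := by
    obtain ⟨a, b, hb, h⟩ := hu
    exact ⟨b, a, h ▸ u.isUnit.mul hb, by rw [← h, Units.inv_mul_cancel_left]⟩
  have ht (i : ℕ) : (tUnit k p i : R k p) ∈ frac :=
    ⟨MvPolynomial.X i, 1, by simp, by simp [ofMvPolynomial]⟩
  have hz (u : (R k p)ˣ) (hu : (u : R k p) ∈ frac) (n : ℤ) :
      ((u ^ n : (R k p)ˣ) : R k p) ∈ frac := by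
    obtain ⟨m, rfl | rfl⟩ := n.eq_nat_or_neg
    · simpa using frac.pow_mem hu m
    · rw [zpow_neg]
      apply hinv
      simpa using frac.pow_mem hu m
  have hpoly (a : MvPolynomial ℕ k) : coeffMap k p (algebraMap _ _ a) ∈ frac := by
    induction a using MvPolynomial.induction_on with
    | C c => exact ⟨MvPolynomial.C c, 1, by simp, by simp [ofMvPolynomial]⟩
    | add a b ha hb => rw [map_add, map_add]; exact frac.add_mem ha hb
    | mul_X a i ha =>
      rw [map_mul, map_mul]
      refine frac.mul_mem ha ?_
      change coeffMap k p (alpha k i) ∈ frac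
      rw [← Units.mul_inv_cancel_right (coeffMap k p (alpha k i)) (tUnit k p i),
        coeffMap_alpha_mul]
      exact frac.mul_mem (frac.pow_mem (ht _) _) (hinv _ (ht i))
  change x ∈ frac
  induction x using monomial_induction with
  | add x y hx hy => exact frac.add_mem hx hy
  | monomial c i n =>
    refine frac.mul_mem ?_ (hz _ (ht i) n)
    obtain ⟨a, b, hb, rfl⟩ := IsFractionRing.div_surjective (A := MvPolynomial ℕ k) c
    have hb' : algebraMap (MvPolynomial ℕ k) (CoeffField k) b ≠ 0 :=
      IsFractionRing.to_map_ne_zero_of_mem_nonZeroDivisors hb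
    rw [div_eq_mul_inv, map_mul]
    exact frac.mul_mem (hpoly a)
      (hinv (Units.map (coeffMap k p).toMonoidHom (Units.mk0 _ hb')) (hpoly b))

instance : UniqueFactorizationMonoid (R k p) := by
  let _ : Algebra (MvPolynomial ℕ k) (R k p) := (ofMvPolynomial k p).toAlgebra
  have : IsLocalization ((IsUnit.submonoid (R k p)).comap (ofMvPolynomial k p)) (R k p) :=
    { map_units := fun b => b.2
      surj := fun x => by
        obtain ⟨a, b, hb, h⟩ := exists_mul_ofMvPolynomial_eq k p x
        exact ⟨(a, ⟨b, hb⟩), h⟩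
      exists_of_eq := fun h => ⟨1, by rw [ofMvPolynomial_injective k p h]⟩ }
  exact UniqueFactorizationMonoid.of_isLocalization
    ((IsUnit.submonoid (R k p)).comap (ofMvPolynomial k p)) (R k p)

instance (F : Type*) [Field F] : IsPrincipalIdealRing F[T;T⁻¹] where
  principal I := by
    rw [← IsLocalization.map_under (.powers (Polynomial.X : Polynomial F)) F[T;T⁻¹] I]
    infer_instance

instance : IsBezout (R k p) := by
  rw [IsBezout.iff_span_pair_isPrincipal]
  intro x y
  obtain ⟨i, a, b, rfl, rfl⟩ := exists_fromLevel₂ x y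
  have : (Ideal.span {a, b}).map (fromLevel k p i) =
      Ideal.span {fromLevel k p i a, fromLevel k p i b} := by
    rw [Ideal.map_span, Set.image_pair]
  rw [← this]
  infer_instance

instance : IsPrincipalIdealRing (R k p) := 
  have h : IsPrincipalIdealRing (R k p) ↔ UniqueFactorizationMonoid (R k p) :=
    IsBezout.TFAE.out 1 2
  h.2 inferInstance

variable {k p} in
theorem exists_prime_map_fromLevel_eq (P : Ideal (R k p)) [hP : P.IsPrime] :
    ∃ (i : ℕ) (Q : Ideal (Level k i)), Q.IsPrime ∧ P = Q.map (fromLevel k p i) := by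
  obtain ⟨f, rfl⟩ := (IsPrincipalIdealRing.principal P).principal
  obtain ⟨i, y, rfl⟩ := exists_fromLevel f
  refine ⟨i, _, hP.comap (fromLevel k p i), le_antisymm ?_ Ideal.map_comap_le⟩
  refine (Ideal.span_singleton_le_iff_mem _).2 (Ideal.mem_map_of_mem _ ?_)
  exact Ideal.mem_comap.2 (Ideal.mem_span_singleton_self _)

end Factorial

/-! ### The grading by rational degrees -/

section Grading

open scoped DirectSum

variable {k : Type*} [Field k] {p : ℕ → ℕ}

variable (p) in
/-- The degree `n / (p₀ ⋯ pᵢ₋₁)` of `tᵢⁿ`. -/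
def monomialDegree (i : ℕ) (n : ℤ) : ℚ := (n : ℚ) / ((∏ j ∈ Finset.range i, p j : ℕ) : ℚ)

theorem monomialDegree_zero (i : ℕ) : monomialDegree p i 0 = 0 := by simp [monomialDegree]

theorem monomialDegree_add (i : ℕ) (m n : ℤ) :
    monomialDegree p i (m + n) = monomialDegree p i m + monomialDegree p i n := by
  simp [monomialDegree, add_div]

theorem monomialDegree_succ (hp : ∀ i, (p i).Prime) (i : ℕ) (n : ℤ) :
    monomialDegree p (i + 1) (p i * n) = monomialDegree p i n := by
  have h : (p i : ℚ) ≠ 0 := Nat.cast_ne_zero.2 (hp i).ne_zero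
  rw [monomialDegree, monomialDegree, Finset.prod_range_succ]
  push_cast
  rw [mul_comm, mul_div_mul_right _ _ h]

theorem monomial_mem (c : CoeffField k) (i : ℕ) (n : ℤ) :
    coeffMap k p c * ((tUnit k p i ^ n : (R k p)ˣ) : R k p) ∈
      homogeneousPart k p (monomialDegree p i n) :=
  AddSubgroup.subset_closure ⟨i, n, c, rfl, by rw [map_mul, fromLevel_C, fromLevel_T]⟩

theorem coeffMap_mem (c : CoeffField k) : coeffMap k p c ∈ homogeneousPart k p 0 := by
  have := monomial_mem (p := p) c 0 0
  rwa [zpow_zero, Units.val_one, mul_one, monomialDegree_zero] at this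

theorem tUnit_zpow_mem (i : ℕ) (n : ℤ) : ((tUnit k p i ^ n : (R k p)ˣ) : R k p) ∈
    homogeneousPart k p (monomialDegree p i n) := by
  simpa using monomial_mem (p := p) (1 : CoeffField k) i n

theorem homogeneousPart_induction {q : ℚ} {motive : (x : R k p) → x ∈ homogeneousPart k p q → Prop}
    (monomial : ∀ c i (n : ℤ) (h : monomialDegree p i n = q),
      motive (coeffMap k p c * ((tUnit k p i ^ n : (R k p)ˣ) : R k p)) (h ▸ monomial_mem c i n))
    (zero : motive 0 (zero_mem _))
    (add : ∀ x y hx hy, motive x hx → motive y hy → motive (x + y) (add_mem hx hy))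
    (neg : ∀ x hx, motive x hx → motive (-x) (neg_mem hx))
    {x : R k p} (hx : x ∈ homogeneousPart k p q) : motive x hx := by
  refine AddSubgroup.closure_induction ?_ zero add neg hx
  rintro _ ⟨i, n, c, h, rfl⟩
  have := monomial c i n h
  simp only [map_mul, fromLevel_C, fromLevel_T]
  exact this

theorem tUnit_zpow_succ (i : ℕ) (n : ℤ) : ((tUnit k p i ^ n : (R k p)ˣ) : R k p) =
    coeffMap k p (alpha k i ^ (-n)) * ((tUnit k p (i + 1) ^ (p i * n) : (R k p)ˣ) : R k p) := by
  have h : Units.map (coeffMap k p).toMonoidHom (Units.mk0 _ (alpha_ne_zero k i)) *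
      tUnit k p i = tUnit k p (i + 1) ^ p i := Units.ext (coeffMap_alpha_mul i)
  have h2 : tUnit k p i ^ n = Units.map (coeffMap k p).toMonoidHom
      (Units.mk0 _ (alpha_ne_zero k i) ^ (-n)) * tUnit k p (i + 1) ^ (p i * n) := by
    rw [zpow_mul, zpow_natCast, ← h, mul_zpow, map_zpow, ← mul_assoc, ← zpow_add,
      neg_add_cancel, zpow_zero, one_mul]
  rw [h2, Units.val_mul]
  refine congrArg (· * _) ?_
  rw [Units.coe_map, Units.val_zpow_eq_zpow_val]
  rfl

/-- A monomial in `tᵢ` is a monomial in `tⱼ` of the same degree, for `i ≤ j`. -/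
theorem exists_monomial_eq_of_le (hp : ∀ i, (p i).Prime) {i j : ℕ} (hij : i ≤ j)
    (c : CoeffField k) (n : ℤ) :
    ∃ d, ∃ m : ℤ, coeffMap k p c * ((tUnit k p i ^ n : (R k p)ˣ) : R k p) =
      coeffMap k p d * ((tUnit k p j ^ m : (R k p)ˣ) : R k p) ∧
      monomialDegree p i n = monomialDegree p j m := by
  induction j, hij using Nat.le_induction with
  | base => exact ⟨c, n, rfl, rfl⟩
  | succ j hij ih =>
    obtain ⟨d, m, h, h'⟩ := ih
    exact ⟨d * alpha k j ^ (-m), p j * m, by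
      rw [h, tUnit_zpow_succ, map_mul, mul_assoc], by rw [h', monomialDegree_succ hp]⟩

theorem gradedMonoid_homogeneousPart (hp : ∀ i, (p i).Prime) :
    SetLike.GradedMonoid (homogeneousPart k p) where
  one_mem := by simpa using coeffMap_mem (k := k) (p := p) 1
  mul_mem := by
    intro q r x y hx hy
    induction hx using homogeneousPart_induction with
    | zero => rw [zero_mul]; exact zero_mem _
    | add x x' _ _ h h' => rw [add_mul]; exact add_mem h h'
    | neg x _ h => rw [neg_mul]; exact neg_mem h
    | monomial c i n h =>
      induction hy using homogeneousPart_induction with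
      | zero => rw [mul_zero]; exact zero_mem _
      | add x x' _ _ h h' => rw [mul_add]; exact add_mem h h'
      | neg x _ h => rw [mul_neg]; exact neg_mem h
      | monomial d j m h' =>
        obtain ⟨c', n', e, e'⟩ := exists_monomial_eq_of_le hp (le_max_left i j) c n
        obtain ⟨d', m', f, f'⟩ := exists_monomial_eq_of_le hp (le_max_right i j) d m
        rw [e, f, ← h, ← h', e', f', ← monomialDegree_add, mul_mul_mul_comm, ← map_mul,
          ← Units.val_mul, ← zpow_add]
        exact monomial_mem _ _ _

theorem directSum_of_congr {q r : ℚ} {x y : R k p} (hq : q = r) (hxy : x = y)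
    (hx : x ∈ homogeneousPart k p q) (hy : y ∈ homogeneousPart k p r) :
    DirectSum.of (fun q => homogeneousPart k p q) q ⟨x, hx⟩ = .of _ r ⟨y, hy⟩ := by
  subst hq hxy
  rfl

section Decomposition

variable [SetLike.GradedMonoid (homogeneousPart k p)]

theorem directSum_of_mul {q r : ℚ} {x y : R k p}
    (hx : x ∈ homogeneousPart k p q) (hy : y ∈ homogeneousPart k p r) :
    DirectSum.of (fun q => homogeneousPart k p q) q ⟨x, hx⟩ * .of _ r ⟨y, hy⟩ =
      .of _ (q + r) ⟨x * y, SetLike.mul_mem_graded hx hy⟩ :=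
  DirectSum.of_mul_of _ _

variable (k p) in
/-- The elements of `K`, as elements of degree `0` of the direct sum of the homogeneous parts. -/
def coeffToDirectSum : CoeffField k →+* ⨁ q, homogeneousPart k p q where
  toFun c := .of (fun q => homogeneousPart k p q) 0 ⟨coeffMap k p c, coeffMap_mem c⟩
  map_one' := directSum_of_congr rfl (map_one _) _ (SetLike.one_mem_graded (homogeneousPart k p))
  map_mul' c d := by
    rw [directSum_of_mul]
    exact directSum_of_congr (add_zero 0).symm (map_mul _ _ _) _ _
  map_zero' := by
    rw [← map_zero (DirectSum.of (fun q => homogeneousPart k p q) 0)]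
    exact directSum_of_congr rfl (map_zero _) _ (zero_mem _)
  map_add' c d := by
    rw [← map_add]
    exact directSum_of_congr rfl (map_add _ _ _) _ (add_mem (coeffMap_mem c) (coeffMap_mem d))

variable (k p) in
/-- The element `tᵢⁿ`, as a homogeneous element of the direct sum. -/
def zpowToDirectSum (i : ℕ) : Multiplicative ℤ →* ⨁ q, homogeneousPart k p q where
  toFun n := .of (fun q => homogeneousPart k p q) _ ⟨_, tUnit_zpow_mem i n.toAdd⟩
  map_one' := directSum_of_congr (monomialDegree_zero i) (by simp) _ (SetLike.one_mem_graded (homogeneousPart k p))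
  map_mul' m n := by
    rw [directSum_of_mul]
    exact directSum_of_congr (monomialDegree_add i _ _) (by simp [zpow_add]) _ _

variable (k p) in
/-- The element `tᵢ`, as a homogeneous unit of the direct sum. -/
def unitToDirectSum (i : ℕ) : (⨁ q, homogeneousPart k p q)ˣ :=
  Units.map (zpowToDirectSum k p i) (toUnits (Multiplicative.ofAdd 1))

theorem unitToDirectSum_zpow (i : ℕ) (n : ℤ) :
    ((unitToDirectSum k p i ^ n : (⨁ q, homogeneousPart k p q)ˣ) : ⨁ q, homogeneousPart k p q) =
      .of (fun q => homogeneousPart k p q) _ ⟨_, tUnit_zpow_mem i n⟩ := by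
  rw [unitToDirectSum, ← map_zpow, ← map_zpow, ← ofAdd_zsmul, Units.coe_map, smul_eq_mul, mul_one]
  rfl

theorem coeffToDirectSum_alpha_mul (hp : ∀ i, (p i).Prime) (i : ℕ) :
    coeffToDirectSum k p (alpha k i) * unitToDirectSum k p i =
      (unitToDirectSum k p (i + 1) : ⨁ q, homogeneousPart k p q) ^ p i := by
  rw [← zpow_one (unitToDirectSum k p i), unitToDirectSum_zpow, ← Units.val_pow_eq_pow_val,
    ← zpow_natCast, unitToDirectSum_zpow]
  refine (directSum_of_mul _ _).trans (directSum_of_congr ?_ ?_ _ _)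
  · rw [zero_add, ← monomialDegree_succ hp, mul_one]
  · rw [zpow_one, coeffMap_alpha_mul, zpow_natCast, Units.val_pow_eq_pow_val]

/-- The decomposition of the elements of `R` into homogeneous components. -/
def toDirectSum (hp : ∀ i, (p i).Prime) : R k p →+* ⨁ q, homogeneousPart k p q :=
  lift p (coeffToDirectSum k p) (unitToDirectSum k p) (coeffToDirectSum_alpha_mul hp)

theorem toDirectSum_monomial (hp : ∀ i, (p i).Prime) (c : CoeffField k) (i : ℕ) (n : ℤ) :
    toDirectSum hp (coeffMap k p c * ((tUnit k p i ^ n : (R k p)ˣ) : R k p)) =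
      .of (fun q => homogeneousPart k p q) _ ⟨_, monomial_mem c i n⟩ := by
  rw [toDirectSum, map_mul, lift_coeffMap, lift_tUnit_zpow, unitToDirectSum_zpow]
  exact (directSum_of_mul _ _).trans (directSum_of_congr (zero_add _) rfl _ _)

theorem toDirectSum_of_mem (hp : ∀ i, (p i).Prime) {q : ℚ} {x : R k p}
    (hx : x ∈ homogeneousPart k p q) :
    toDirectSum hp x = .of (fun q => homogeneousPart k p q) q ⟨x, hx⟩ := by
  induction hx using homogeneousPart_induction with
  | zero => rw [map_zero]; exact (map_zero (DirectSum.of _ q)).symm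
  | add x y hx hy h h' => rw [map_add, h, h', ← map_add]; rfl
  | neg x hx h => rw [map_neg, h, ← map_neg]; rfl
  | monomial c i n h =>
    rw [toDirectSum_monomial]
    exact directSum_of_congr h rfl _ _

/-- The decomposition of `R` into its homogeneous parts. -/
abbrev homogeneousDecomposition (hp : ∀ i, (p i).Prime) :
    DirectSum.Decomposition (homogeneousPart k p) :=
  .ofAddHom (homogeneousPart k p) (toDirectSum hp).toAddMonoidHom
    (by
      ext x
      change DirectSum.coeAddMonoidHom (homogeneousPart k p) (toDirectSum hp x) = x
      induction x using monomial_induction with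
      | monomial c i n => rw [toDirectSum_monomial, DirectSum.coeAddMonoidHom_of]
      | add x y hx hy => rw [map_add, map_add, hx, hy])
    (by
      refine DirectSum.addHom_ext' fun q => AddMonoidHom.ext fun x => ?_
      change toDirectSum hp (DirectSum.coeAddMonoidHom (homogeneousPart k p) (.of _ q x)) = _
      rw [DirectSum.coeAddMonoidHom_of]
      exact toDirectSum_of_mem hp x.2)

end Decomposition

theorem nonempty_gradedRing (hp : ∀ i, (p i).Prime) :
    Nonempty (GradedRing (homogeneousPart k p)) :=
  have := gradedMonoid_homogeneousPart (k := k) hp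
  ⟨{ homogeneousDecomposition hp with }⟩

end Grading

/-! ### Residue fields, units and division with remainder -/

section Residue

variable {k : Type*} [Field k] {p : ℕ → ℕ}

/-- The degree in `α_N` of a rational function: the degree of the numerator minus that of the
denominator. -/
def ratDegree (N : ℕ) (x : CoeffField k) : ℤ :=
  (IsFractionRing.num (MvPolynomial ℕ k) x).degreeOf N -
    (IsFractionRing.den (MvPolynomial ℕ k) x : MvPolynomial ℕ k).degreeOf N

theorem ratDegree_eq (N : ℕ) {x : CoeffField k} {a b : MvPolynomial ℕ k} (ha : a ≠ 0) (hb : b ≠ 0)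
    (h : x * algebraMap _ _ b = algebraMap _ _ a) :
    ratDegree N x = a.degreeOf N - b.degreeOf N := by
  have hinj := IsFractionRing.injective (MvPolynomial ℕ k) (CoeffField k)
  set c := IsFractionRing.num (MvPolynomial ℕ k) x with hc
  set d := (IsFractionRing.den (MvPolynomial ℕ k) x : MvPolynomial ℕ k) with hd
  have hd0 : d ≠ 0 := nonZeroDivisors.coe_ne_zero _
  have hx : x * algebraMap _ _ d = algebraMap _ _ c := by
    have := IsFractionRing.mk'_num_den (MvPolynomial ℕ k) x
    exact (IsLocalization.eq_mk'_iff_mul_eq).1 this.symm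
  have hac : a * d = c * b := by
    apply hinj
    rw [map_mul, map_mul, ← h, ← hx]
    ring
  have hc0 : c ≠ 0 := by
    rintro h0
    rw [h0, zero_mul] at hac
    exact mul_ne_zero ha hd0 hac
  have := congrArg (MvPolynomial.degreeOf N) hac
  rw [MvPolynomial.degreeOf_mul_eq ha hd0, MvPolynomial.degreeOf_mul_eq hc0 hb] at this
  rw [ratDegree, ← hc, ← hd]
  omega

theorem exists_fraction {x : CoeffField k} (hx : x ≠ 0) :
    ∃ a b : MvPolynomial ℕ k, a ≠ 0 ∧ b ≠ 0 ∧ x * algebraMap _ _ b = algebraMap _ _ a := by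
  obtain ⟨a, b, hb, rfl⟩ := IsFractionRing.div_surjective (A := MvPolynomial ℕ k) x
  have hb' : algebraMap (MvPolynomial ℕ k) (CoeffField k) b ≠ 0 :=
    IsFractionRing.to_map_ne_zero_of_mem_nonZeroDivisors hb
  refine ⟨a, b, ?_, nonZeroDivisors.ne_zero hb, div_mul_cancel₀ _ hb'⟩
  rintro rfl
  simp at hx

theorem ratDegree_mul (N : ℕ) {x y : CoeffField k} (hx : x ≠ 0) (hy : y ≠ 0) :
    ratDegree N (x * y) = ratDegree N x + ratDegree N y := by
  obtain ⟨a, b, ha, hb, h⟩ := exists_fraction hx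
  obtain ⟨c, d, hc, hd, h'⟩ := exists_fraction hy
  rw [ratDegree_eq N ha hb h, ratDegree_eq N hc hd h',
    ratDegree_eq N (mul_ne_zero ha hc) (mul_ne_zero hb hd)
      (by rw [map_mul, map_mul, mul_mul_mul_comm, h, h']),
    MvPolynomial.degreeOf_mul_eq ha hc, MvPolynomial.degreeOf_mul_eq hb hd]
  push_cast
  ring

theorem ratDegree_pow (N : ℕ) {x : CoeffField k} (hx : x ≠ 0) (n : ℕ) :
    ratDegree N (x ^ n) = n * ratDegree N x := by
  induction n with
  | zero =>
    rw [pow_zero, ratDegree_eq (a := 1) (b := 1) N one_ne_zero one_ne_zero (by simp)]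
    simp
  | succ n ih => rw [pow_succ, ratDegree_mul N (pow_ne_zero _ hx) hx, ih]; push_cast; ring

theorem ratDegree_alpha (N i : ℕ) : ratDegree N (alpha k i) = if N = i then 1 else 0 := by
  classical
  rw [ratDegree_eq (a := MvPolynomial.X i) (b := 1) N (MvPolynomial.X_ne_zero i) one_ne_zero
    (by simp [alpha]), MvPolynomial.degreeOf_X, MvPolynomial.degreeOf_one]
  split_ifs <;> simp

theorem exists_ratDegree_eq_zero {x : CoeffField k} (hx : x ≠ 0) : ∃ N, ratDegree N x = 0 := by
  classical
  obtain ⟨a, b, ha, hb, h⟩ := exists_fraction hx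
  obtain ⟨N, hN⟩ := Infinite.exists_notMem_finset (a.vars ∪ b.vars)
  rw [Finset.mem_union, not_or, MvPolynomial.mem_vars_iff_degreeOf_ne_zero,
    MvPolynomial.mem_vars_iff_degreeOf_ne_zero, not_not, not_not] at hN
  exact ⟨N, by rw [ratDegree_eq N ha hb h, hN.1, hN.2, sub_self]⟩

/-- `R` has no `K`-rational point. The images `βᵢ` of the `tᵢ` would satisfy
`βᵢ₊₁ ^ pᵢ = αᵢ βᵢ`. If `β₀` does not involve `α_N`, then `β₀, …, β_N` have degree `0` in `α_N`, and
`β_{N+1} ^ p_N` has degree `1`, which is not a multiple of `p_N`. -/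
theorem comp_coeffMap_ne_id (hp : ∀ i, (p i).Prime) (χ : R k p →+* CoeffField k) :
    χ.comp (coeffMap k p) ≠ RingHom.id _ := by
  intro hχ
  have hχ' (c : CoeffField k) : χ (coeffMap k p c) = c := DFunLike.congr_fun hχ c
  let β (i : ℕ) : CoeffField k := χ (tUnit k p i)
  have hβ0 (i : ℕ) : β i ≠ 0 := ((tUnit k p i).isUnit.map χ).ne_zero
  have hβ (i : ℕ) : alpha k i * β i = β (i + 1) ^ p i := by
    rw [← hχ' (alpha k i), ← map_mul, coeffMap_alpha_mul, map_pow]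
  obtain ⟨N, hN⟩ := exists_ratDegree_eq_zero (hβ0 0)
  have hdeg (i : ℕ) : p i * ratDegree N (β (i + 1)) =
      (if N = i then 1 else 0) + ratDegree N (β i) := by
    rw [← ratDegree_pow N (hβ0 _), ← hβ, ratDegree_mul N (alpha_ne_zero k i) (hβ0 i),
      ratDegree_alpha]
  have hzero (i : ℕ) (hi : i ≤ N) : ratDegree N (β i) = 0 := by
    induction i with
    | zero => exact hN
    | succ i ih =>
      have := hdeg i
      rw [ih (by omega), if_neg (by omega), add_zero] at this
      exact (mul_eq_zero.1 this).resolve_left (Nat.cast_ne_zero.2 (hp i).ne_zero)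
  have h1 := hdeg N
  rw [hzero N le_rfl, if_pos rfl, add_zero] at h1
  exact (hp N).one_lt.ne' (by exact_mod_cast Int.eq_one_of_mul_eq_one_right (by positivity) h1)

/-- The residue fields of `R` at maximal ideals are proper extensions of `K`. -/
theorem exists_mk_coeffMap_ne (hp : ∀ i, (p i).Prime) (M : Ideal (R k p)) [M.IsMaximal] :
    ∃ θ : R k p ⧸ M, ∀ c, Ideal.Quotient.mk M (coeffMap k p c) ≠ θ := by
  by_contra! hsurj
  have : Nontrivial (R k p ⧸ M) := Ideal.Quotient.nontrivial_iff.2 (Ideal.IsMaximal.ne_top ‹_›)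
  let e : CoeffField k ≃+* R k p ⧸ M :=
    .ofBijective ((Ideal.Quotient.mk M).comp (coeffMap k p)) ⟨RingHom.injective _, hsurj⟩
  refine comp_coeffMap_ne_id hp ((e.symm : R k p ⧸ M →+* CoeffField k).comp
    (Ideal.Quotient.mk M)) (RingHom.ext fun c => ?_)
  exact e.symm_apply_apply c

/-- For a maximal ideal `M` of `R`, the units of `R` do not surject onto those of `R / M`: the group
`Rˣ / Kˣ` is countable, whereas for `θ ∈ R / M` outside `K` the uncountably many units `θ + c`,
`c ∈ k`, are pairwise distinct modulo `Kˣ`. -/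
theorem not_surjective_units_map [Uncountable k] (hp : ∀ i, (p i).Prime) (M : Ideal (R k p))
    [M.IsMaximal] :
    ¬ Function.Surjective (Units.map (Ideal.Quotient.mk M).toMonoidHom) := by
  intro hsurj
  obtain ⟨θ, hθ⟩ := exists_mk_coeffMap_ne hp M
  let _ : Field (R k p ⧸ M) := Ideal.Quotient.field M
  let ι : CoeffField k →+* R k p ⧸ M := (Ideal.Quotient.mk M).comp (coeffMap k p)
  let γ : k →+* CoeffField k := (algebraMap (MvPolynomial ℕ k) _).comp MvPolynomial.C
  have hθ' (c : CoeffField k) : ι c ≠ θ := hθ c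
  have hunit (c : k) : ∃ (x : CoeffField k) (m : ℕ × ℤ), θ + ι (γ c) =
      ι x * Ideal.Quotient.mk M ((tUnit k p m.1 ^ m.2 : (R k p)ˣ) : R k p) := by
    have hne : θ + ι (γ c) ≠ 0 := fun h =>
      hθ' (-γ c) (by rw [map_neg]; exact (eq_neg_of_add_eq_zero_left h).symm)
    obtain ⟨w, hw⟩ := hsurj (Units.mk0 _ hne)
    obtain ⟨x, i, n, h⟩ := exists_eq_monomial_of_isUnit w.isUnit
    refine ⟨x, (i, n), ?_⟩
    have hw' : Ideal.Quotient.mk M (w : R k p) = θ + ι (γ c) := congrArg Units.val hw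
    rw [← hw', h, map_mul]
    rfl
  choose x m hxm using hunit
  have hm : ¬ Function.Injective m := fun h => not_countable (α := k) h.countable
  simp only [Function.Injective, not_forall] at hm
  obtain ⟨c, d, hcd, hne⟩ := hm
  have hc := hxm c
  have hd := hxm d
  rw [← hcd] at hd
  -- The ratio of `θ + c` and `θ + d` is `x c / x d ∈ K`, a linear equation for `θ` over `K`.
  have key : ι (x d - x c) * θ = ι (x c * γ d - x d * γ c) := by
    simp only [map_sub, map_mul]
    linear_combination ι (x d) * hc - ι (x c) * hd
  by_cases h : x d = x c
  · have hx0 : x c ≠ 0 := by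
      intro h0
      rw [h0, map_zero, zero_mul] at hc
      exact hθ' (-γ c) (by rw [map_neg]; exact (eq_neg_of_add_eq_zero_left hc).symm)
    rw [h, sub_self, map_zero, zero_mul, ← mul_sub, eq_comm, map_eq_zero] at key
    have := (mul_eq_zero.1 key).resolve_left hx0
    exact hne (γ.injective (sub_eq_zero.1 this).symm)
  · refine hθ' ((x c * γ d - x d * γ c) / (x d - x c)) ?_
    rw [map_div₀, ← key, mul_div_cancel_left₀]
    exact (map_ne_zero ι).2 (sub_ne_zero.2 h)

/-- A proper ideal `M` of `R` does not have all its cosets represented by `0` and units: otherwise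
`R / M` would be a field all of whose units lift to `R`. -/
theorem exists_forall_sub_mem [Uncountable k] (hp : ∀ i, (p i).Prime) {M : Ideal (R k p)}
    (hM : M ≠ ⊤) : ∃ a, ∀ s, a - s ∈ M → s ≠ 0 ∧ ¬ IsUnit s := by
  by_contra! h
  have hmem (a : R k p) (ha : a ∉ M) : ∃ s, a - s ∈ M ∧ IsUnit s := by
    obtain ⟨s, hs, hs'⟩ := h a
    refine ⟨s, hs, hs' ?_⟩
    rintro rfl
    exact ha (by rwa [sub_zero] at hs)
  have : M.IsMaximal := Ideal.isMaximal_iff.2 ⟨(Ideal.ne_top_iff_one M).1 hM, by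
    intro J a hMJ ha haJ
    obtain ⟨s, hs, hu⟩ := hmem a ha
    have hsJ : s ∈ J := by simpa using J.sub_mem haJ (hMJ hs)
    rw [Ideal.eq_top_of_isUnit_mem J hsJ hu]
    trivial⟩
  have hnt : Nontrivial (R k p ⧸ M) := Ideal.Quotient.nontrivial_iff.2 hM
  refine not_surjective_units_map hp M fun u => ?_
  obtain ⟨a, ha⟩ := Ideal.Quotient.mk_surjective (u : R k p ⧸ M)
  obtain ⟨s, hs, hu⟩ := hmem a fun haM =>
    u.ne_zero (ha ▸ Ideal.Quotient.eq_zero_iff_mem.2 haM)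
  refine ⟨hu.unit, Units.ext ?_⟩
  rw [← ha]
  exact ((Ideal.Quotient.mk_eq_mk_iff_sub_mem a s).2 hs).symm

/-- With a division with remainder, modulo a minimal nonzero nonunit `b` every element would be
congruent to `0` or a unit. Without nonzero nonunits the same would hold modulo `0`. -/
theorem not_hasEuclideanDivision [Uncountable k] (hp : ∀ i, (p i).Prime) :
    ¬ HasEuclideanDivision (R k p) := by
  rintro ⟨r, hr, hdiv⟩
  by_cases hne : ∃ b : R k p, b ≠ 0 ∧ ¬ IsUnit b
  · obtain ⟨b, ⟨hb0, hbu⟩, hmin⟩ := hr.has_min {b : R k p | b ≠ 0 ∧ ¬ IsUnit b} hne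
    obtain ⟨a, ha⟩ := exists_forall_sub_mem hp (M := Ideal.span {b})
      (by rwa [Ne, Ideal.span_singleton_eq_top])
    obtain ⟨q, s, rfl, hs⟩ := hdiv a b hb0
    obtain ⟨hs0, hsu⟩ := ha s (by
      rw [add_sub_cancel_right]
      exact Ideal.mul_mem_right _ _ (Ideal.mem_span_singleton_self b))
    exact hmin s ⟨hs0, hsu⟩ (hs.resolve_left hs0)
  · obtain ⟨a, ha⟩ := exists_forall_sub_mem hp (M := (⊥ : Ideal (R k p))) bot_ne_top
    exact hne ⟨a, ha a (by simp)⟩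

end Residue

end RationalGraded

end

theorem proposition4p10 {k : Type*} [Field k] [CharZero k] [Uncountable k]
    (p : ℕ → ℕ) (hp : ∀ i, (p i).Prime)
    (hQ : ∀ q : ℚ, ∃ (i : ℕ) (n : ℤ), q = (n : ℚ) / ((∏ j ∈ Finset.range i, p j : ℕ) : ℚ)) :
    -- `R(k,1)` is a `ℚ`-graded Noetherian ring
    Nonempty (GradedRing (RationalGraded.homogeneousPart k p)) ∧
    IsNoetherianRing (RationalGraded.R k p) ∧
    -- it is a principal ideal domain
    IsDomain (RationalGraded.R k p) ∧
    IsPrincipalIdealRing (RationalGraded.R k p) ∧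
    -- every prime ideal is extended from one of the principal ideal domains `Rᵢ`
    (∀ i, IsPrincipalIdealRing (RationalGraded.Level k i)) ∧
    (∀ P : Ideal (RationalGraded.R k p), P.IsPrime →
      ∃ (i : ℕ) (Q : Ideal (RationalGraded.Level k i)),
        Q.IsPrime ∧ P = Q.map (RationalGraded.fromLevel k p i)) ∧
    -- it is not a Euclidean domain
    ¬ RationalGraded.HasEuclideanDivision (RationalGraded.R k p) ∧
    -- for no prime element `f` do the units of `R` surject onto the units of `R / fR`
    (∀ f : RationalGraded.R k p, Prime f →
      ¬ Function.Surjective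
        (Units.map (Ideal.Quotient.mk (Ideal.span {f})).toMonoidHom)) := by
  refine ⟨RationalGraded.nonempty_gradedRing hp, inferInstance, inferInstance, inferInstance,
    fun _ => inferInstance, fun P _ => RationalGraded.exists_prime_map_fromLevel_eq P,
    RationalGraded.not_hasEuclideanDivision hp, fun f hf => ?_⟩
  have := PrincipalIdealRing.isMaximal_of_irreducible hf.irreducible
  exact RationalGraded.not_surjective_units_map hp _
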